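/- Let $p$ be a prime, let $\mathbb F_p$ be the field with $p$ elements, and let $G_p=\bigoplus_{n=1}^{\infty}\mathbb F_p$ be the countable direct sum of copies of $\mathbb F_p$ with coordinatewise addition. Put $\delta_2=\frac12$ and $\delta_p=\frac12-\frac1{2p}$ for odd $p$. For an abelian group $G$, a Følner sequence is a sequence $\Phi=(\Phi_n)_{n\in\mathbb N}$ of finite nonempty subsets of $G$ with $\lim_{n\to\infty}|(\Phi_n+g)\triangle\Phi_n|/|\Phi_n|=0$ for every $g\in G$, and the upper Banach density of $A\subseteq G$ is $$d^*(A)=\sup\Big\{\limsup_{n\to\infty}\frac{|A\cap\Phi_n|}{|\Phi_n|} : (\Phi_n)_{n\in\mathbb N}\text{ is a Følner sequence for }G\Big\}.$$ The Bohr topology of $G$ is the weakest topology on $G$ for which every homomorphism $G\to\mathbb R/\mathbb Z$ is continuous; a Bohr neighborhood of $g\in G$ is a set containing a Bohr-open set that contains $g$. Write $A-A=\{a-b: a,b\in A\}$. 1. For every $\varepsilon>0$ there is a set $A\subseteq G_p$ with $d^*(A)>\delta_p-\varepsilon$ such that $A-A$ does not contain a Bohr neighborhood of any $g\in G_p$.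 2. If $A\subseteq G_p$ satisfies $d^*(A)>\delta_p$, then $A-A=G_p$. -/

import Mathlib

open Filter Topology MeasureTheory
open scoped Pointwise

noncomputable section

/-- The countable direct sum of copies of `𝔽_p`, with coordinatewise addition. -/
abbrev Gp (p : ℕ) : Type := ℕ →₀ ZMod p

/-- A Følner sequence of a (discrete) abelian group `G`: a sequence of finite subsets `Φ n`
(nonempty from some index on) with `|(Φ n + g) ∆ Φ n| / |Φ n| → 0` for every `g : G`.
This is Mathlib's notion for the translation action of `G` on itself and counting measure. -/
def IsFolnerSeq {G : Type*} [AddCommGroup G] (Φ : ℕ → Finset G) : Prop :=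
  letI : MeasurableSpace G := ⊤
  IsAddFoelner G (Measure.count : Measure G) atTop (fun n => (Φ n : Set G))

/-- The upper density `limsup |A ∩ Φ n| / |Φ n|` of `A` with respect to a sequence of finite
sets `Φ n`. (The terms lie in `[0, 1]`, so the real `limsup` is the usual one.) -/
def upperDensity {G : Type*} (Φ : ℕ → Finset G) (A : Set G) : ℝ :=
  limsup (fun n => ((A ∩ (Φ n : Set G)).ncard : ℝ) / ((Φ n).card : ℝ)) atTop

/-- The upper Banach density: the supremum of the upper densities of `A` with respect to all
Følner sequences. -/
def upperBanachDensity {G : Type*} [AddCommGroup G] (A : Set G) : ℝ :=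
  sSup {d : ℝ | ∃ Φ : ℕ → Finset G, IsFolnerSeq Φ ∧ d = upperDensity Φ A}

/-- The Bohr topology of a discrete abelian group `G`: the weakest topology for which every
homomorphism `G → ℝ/ℤ` is continuous. -/
abbrev bohrTopology (G : Type*) [AddCommGroup G] : TopologicalSpace G :=
  ⨅ ρ : G →+ UnitAddCircle, TopologicalSpace.induced ρ inferInstance

/-- `B` is a Bohr neighborhood of `g`: it contains a Bohr-open set that contains `g`. -/
def IsBohrNhd {G : Type*} [AddCommGroup G] (B : Set G) (g : G) : Prop :=
  B ∈ @nhds G (bohrTopology G) g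

/-- The critical density `δ_p`: `1/2` for `p = 2`, and `1/2 - 1/(2p)` for odd `p`. -/
def criticalDensity (p : ℕ) : ℝ :=
  if p = 2 then 1 / 2 else 1 / 2 - 1 / (2 * (p : ℝ))

end

/-! Upper bound: if `g ∉ A - A`, then for every `x` the `j` with `x + j • g ∈ A` contain no two
cyclic neighbours in `ZMod p`, so there are at most `⌊p/2⌋` of them. Averaging over Følner sets
gives `d*(A) ≤ ⌊p/2⌋/p = δ_p` (`upperBanachDensity_le_of_notMem_sub`).

Construction: start from the multiples `0, 2, 4, …` of the basis vector `e = single 0 1`, a set of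
density `δ_p` whose differences omit `e`. To make the differences of `A`, living on the first `m`
coordinates, omit points Bohr-close to `g`, append a long block `y` having a clear plurality letter
`c y`, and shift `A` by `c y • (g + e)`. Adding `1 + u` to the block, `u` sparse, raises the
plurality by one; if `g + (1 + u)` were a difference, the shifts would force `e ∈ A - A`
(`Stage.exists_extension`). Almost all blocks have a clear plurality
(`tendsto_card_not_isPlurality`), so little density is lost.

Finitely many characters always vanish together on some `1 + u` with `u` sparse
(`exists_card_ne_zero_le_forall_map_eq_zero`), so each Bohr neighborhood of `g` meets the omitted
points. Handling every `g` infinitely often, with growing sparsity bounds and summable losses, gives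
the set. -/

/-! ### Følner sequences and upper densities. -/

open scoped symmDiff in
open scoped Classical in
theorem IsFolnerSeq.tendsto_card_symmDiff {G : Type*} [AddCommGroup G] {Φ : ℕ → Finset G}
    (hΦ : IsFolnerSeq Φ) (g : G) :
    Tendsto (fun n => (((g +ᵥ Φ n) ∆ Φ n).card : ℝ) / ((Φ n).card : ℝ)) atTop (𝓝 0) := by
  let _ : MeasurableSpace G := ⊤
  have h := hΦ.tendsto_meas_vadd_symmDiff g
  have h2 := (ENNReal.tendsto_toReal ENNReal.zero_ne_top).comp h
  refine h2.congr fun n => ?_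
  have e : (g +ᵥ (Φ n : Set G)) ∆ (Φ n : Set G) = (((g +ᵥ Φ n) ∆ Φ n : Finset G) : Set G) := by
    simp
  simp only [Function.comp_apply]
  rw [e, Measure.count_apply_finset, Measure.count_apply_finset]
  simp [ENNReal.toReal_div]

theorem IsFolnerSeq.eventually_nonempty {G : Type*} [AddCommGroup G] {Φ : ℕ → Finset G}
    (hΦ : IsFolnerSeq Φ) : ∀ᶠ n in atTop, (Φ n).Nonempty := by
  let _ : MeasurableSpace G := ⊤
  filter_upwards [hΦ.eventually_meas_ne_zero] with n hn
  rw [Finset.nonempty_iff_ne_empty]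
  rintro h
  simp [h] at hn

theorem isFolnerSeq_of_eventually_vadd_eq {G : Type*} [AddCommGroup G] {Φ : ℕ → Finset G}
    (hne : ∀ n, (Φ n).Nonempty)
    (hΦ : ∀ g : G, ∀ᶠ n in atTop, g +ᵥ (Φ n : Set G) = (Φ n : Set G)) : IsFolnerSeq Φ := by
  let _ : MeasurableSpace G := ⊤
  refine ⟨Eventually.of_forall fun n => trivial, Eventually.of_forall fun n => ?_,
    Eventually.of_forall fun n => ?_, fun g => ?_⟩
  · rw [Measure.count_apply_finset]
    simpa using (hne n).ne_empty
  · rw [Measure.count_apply_finset]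
    simp
  · refine tendsto_const_nhds.congr' ?_
    filter_upwards [hΦ g] with n hn
    simp [hn]

theorem density_nonneg {G : Type*} (Φ : ℕ → Finset G) (A : Set G) (n : ℕ) :
    0 ≤ ((A ∩ (Φ n : Set G)).ncard : ℝ) / ((Φ n).card : ℝ) := by positivity

theorem density_le_one {G : Type*} (Φ : ℕ → Finset G) (A : Set G) (n : ℕ) :
    ((A ∩ (Φ n : Set G)).ncard : ℝ) / ((Φ n).card : ℝ) ≤ 1 := by
  refine div_le_one_of_le₀ ?_ (by positivity)
  have := Set.ncard_le_ncard (Set.inter_subset_right (s := A)) (Φ n).finite_toSet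
  rw [Set.ncard_coe_finset] at this
  exact_mod_cast this

theorem upperDensity_le {G : Type*} {Φ : ℕ → Finset G} {A : Set G} {c : ℝ}
    (h : ∀ᶠ n in atTop, ((A ∩ (Φ n : Set G)).ncard : ℝ) / ((Φ n).card : ℝ) ≤ c) :
    upperDensity Φ A ≤ c :=
  limsup_le_of_le (IsBoundedUnder.isCoboundedUnder_le
    ⟨0, eventually_map.2 (Eventually.of_forall (density_nonneg Φ A))⟩) h

theorem le_upperDensity {G : Type*} {Φ : ℕ → Finset G} {A : Set G} {c : ℝ}
    (h : ∀ᶠ n in atTop, c ≤ ((A ∩ (Φ n : Set G)).ncard : ℝ) / ((Φ n).card : ℝ)) :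
    c ≤ upperDensity Φ A :=
  le_limsup_of_frequently_le h.frequently
    ⟨1, eventually_map.2 (Eventually.of_forall (density_le_one Φ A))⟩

theorem upperDensity_le_upperBanachDensity {G : Type*} [AddCommGroup G] {Φ : ℕ → Finset G}
    (hΦ : IsFolnerSeq Φ) (A : Set G) : upperDensity Φ A ≤ upperBanachDensity A := by
  refine le_csSup ⟨1, ?_⟩ ⟨Φ, hΦ, rfl⟩
  rintro d ⟨Ψ, -, rfl⟩
  exact upperDensity_le (Eventually.of_forall (density_le_one Ψ A))

/-! ### The upper bound for sets with a missing difference. -/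

theorem criticalDensity_eq {p : ℕ} (hp : p.Prime) :
    criticalDensity p = ((p / 2 : ℕ) : ℝ) / p := by
  unfold criticalDensity
  split_ifs with h
  · subst h; norm_num
  · obtain ⟨k, hk⟩ := hp.odd_of_ne_two h
    have : p / 2 = k := by omega
    have hp0 : (p : ℝ) ≠ 0 := by exact_mod_cast hp.ne_zero
    rw [this]
    field_simp
    rw [hk]; push_cast; ring

theorem ZMod.card_le_half_of_forall_add_one_notMem {p : ℕ} [NeZero p] (J : Finset (ZMod p))
    (hJ : ∀ j ∈ J, j + 1 ∉ J) : J.card ≤ p / 2 := by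
  have hd : Disjoint J (J.image (· + 1)) := by
    rw [Finset.disjoint_left]
    intro a ha hb
    obtain ⟨j, hj, rfl⟩ := Finset.mem_image.1 hb
    exact hJ j hj ha
  have h1 := Finset.card_union_of_disjoint hd
  rw [Finset.card_image_of_injective _ (add_left_injective 1)] at h1
  have h2 := Finset.card_le_univ (J ∪ J.image (· + 1))
  rw [ZMod.card] at h2
  omega

-- Double count the pairs `(j, x)` with `x ∈ Φ` and `j • g + x ∈ A`: each `x` admits at most `p / 2`
-- values of `j`, and for each `j` the translation costs at most one symmetric difference.
open scoped symmDiff in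
open scoped Classical in
theorem card_filter_mul_le {G : Type*} [AddCommGroup G] {p : ℕ} [NeZero p] [Module (ZMod p) G]
    {A : Set G} {g : G} (hg : g ∉ A - A) (Φ : Finset G) :
    p * (Φ.filter (· ∈ A)).card ≤
      Φ.card * (p / 2) + ∑ j : ZMod p, ((j • g +ᵥ Φ) ∆ Φ).card := by
  have h1 : ∀ j : ZMod p, (Φ.filter (· ∈ A)).card ≤
      (Φ.filter (fun x => j • g + x ∈ A)).card + ((j • g +ᵥ Φ) ∆ Φ).card := by
    intro j
    rw [← Finset.card_image_of_injective (Φ.filter (fun x => j • g + x ∈ A))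
      (add_right_injective (j • g))]
    refine (Finset.card_le_card fun x hx => ?_).trans (Finset.card_union_le _ _)
    obtain ⟨hx, hxA⟩ := Finset.mem_filter.1 hx
    by_cases hm : x ∈ j • g +ᵥ Φ
    · obtain ⟨y, hy, rfl⟩ := Finset.mem_vadd_finset.1 hm
      exact Finset.mem_union_left _ (Finset.mem_image.2 ⟨y, Finset.mem_filter.2 ⟨hy, hxA⟩, rfl⟩)
    · exact Finset.mem_union_right _ (Finset.mem_symmDiff.2 (Or.inr ⟨hx, hm⟩))
  have h2 : ∑ j : ZMod p, (Φ.filter (fun x => j • g + x ∈ A)).card ≤ Φ.card * (p / 2) := by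
    simp_rw [Finset.card_filter]
    rw [Finset.sum_comm]
    refine Finset.sum_le_card_nsmul _ _ _ fun x _ => ?_
    rw [← Finset.card_filter]
    refine ZMod.card_le_half_of_forall_add_one_notMem _ fun j hj hj' => hg ?_
    rw [Finset.mem_filter] at hj hj'
    refine ⟨_, hj'.2, _, hj.2, ?_⟩
    simp only [add_smul, one_smul]
    abel
  calc p * (Φ.filter (· ∈ A)).card = ∑ _j : ZMod p, (Φ.filter (· ∈ A)).card := by
        simp [ZMod.card]
    _ ≤ _ := Finset.sum_le_sum fun j _ => h1 j
    _ ≤ _ := by rw [Finset.sum_add_distrib]; gcongr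

open scoped Classical in
theorem upperBanachDensity_le_of_notMem_sub {p : ℕ} [NeZero p] {G : Type*} [AddCommGroup G]
    [Module (ZMod p) G] {A : Set G} {g : G} (hg : g ∉ A - A) :
    upperBanachDensity A ≤ ((p / 2 : ℕ) : ℝ) / p := by
  refine Real.sSup_le ?_ (by positivity)
  rintro d ⟨Φ, hΦ, rfl⟩
  refine le_of_forall_pos_le_add fun η hη => upperDensity_le ?_
  have ht := tendsto_finsetSum (Finset.univ : Finset (ZMod p))
    fun j _ => hΦ.tendsto_card_symmDiff (j • g)
  simp only [Finset.sum_const_zero] at ht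
  filter_upwards [ht.eventually_lt_const hη, hΦ.eventually_nonempty] with n hn hne
  have hc : (0 : ℝ) < (Φ n).card := by exact_mod_cast hne.card_pos
  have hp1 : (1 : ℝ) ≤ p := by exact_mod_cast NeZero.one_le
  have hp0 : (0 : ℝ) < p := by linarith
  have h := card_filter_mul_le (p := p) hg (Φ n)
  have e : A ∩ (Φ n : Set G) = (((Φ n).filter (· ∈ A) : Finset G) : Set G) := by
    ext x; simp [and_comm]
  rw [e, Set.ncard_coe_finset]
  rw [← Finset.sum_div, div_lt_iff₀ hc] at hn
  have h' : (p : ℝ) * ((Φ n).filter (· ∈ A)).card ≤ (Φ n).card * ((p / 2 : ℕ) : ℝ) +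
      η * (Φ n).card := by
    refine le_trans (by exact_mod_cast h) (add_le_add le_rfl hn.le)
  rw [div_le_iff₀ hc]
  have : (((p / 2 : ℕ) : ℝ) / p + η) * (Φ n).card =
    ((Φ n).card * ((p / 2 : ℕ) : ℝ) + p * (η * (Φ n).card)) / p := by field_simp
  rw [this, le_div_iff₀ hp0]
  nlinarith [mul_nonneg (sub_nonneg.2 hp1) (mul_pos hη hc).le]

/-! ### Anticoncentration of differences of letter counts. -/

/-- The number of coordinates of `y` that are equal to `a`. -/
def coordCount {α : Type*} [DecidableEq α] {n : ℕ} (y : Fin n → α) (a : α) : ℕ :=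
  (Finset.univ.filter fun i => y i = a).card

section Anticoncentration

variable {α : Type*} [DecidableEq α] [Fintype α]

theorem sum_zpow_coordCount_sub {a b : α} (hab : a ≠ b) {ζ : ℂ} (hζ : ζ ≠ 0) (n : ℕ) :
    ∑ y : Fin n → α, ζ ^ ((coordCount y a : ℤ) - coordCount y b) =
      (∑ c, if c = a then ζ else if c = b then ζ⁻¹ else 1) ^ n := by
  rw [Fintype.sum_pow]
  refine Finset.sum_congr rfl fun y _ => ?_
  have : ∀ i, (if y i = a then ζ else if y i = b then ζ⁻¹ else 1) =
      (if y i = a then ζ else 1) * (if y i = b then ζ⁻¹ else 1) := by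
    intro i
    split_ifs with h1 h2
    · exact absurd (h1.symm.trans h2) hab
    all_goals simp
  simp_rw [this]
  rw [Finset.prod_mul_distrib, Finset.prod_ite, Finset.prod_ite]
  simp only [Finset.prod_const, one_pow, mul_one, coordCount]
  rw [zpow_sub₀ hζ, zpow_natCast, zpow_natCast, inv_pow, div_eq_mul_inv]

theorem norm_add_inv_lt_two {ζ : ℂ} (h1 : ‖ζ‖ = 1) (h2 : ζ ^ 2 ≠ 1) : ‖ζ + ζ⁻¹‖ < 2 := by
  have hinv : ζ⁻¹ = (starRingEnd ℂ) ζ := by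
    rw [Complex.inv_def, Complex.normSq_eq_norm_sq, h1]; simp
  have him : ζ.im ≠ 0 := by
    intro h
    apply h2
    have hs : (starRingEnd ℂ) ζ = ζ := Complex.conj_eq_iff_im.2 h
    have hz : ζ ≠ 0 := by
      rintro rfl
      simp at h1
    rw [sq]
    nth_rewrite 2 [← hs]
    rw [← hinv, mul_inv_cancel₀ hz]
  have := Complex.abs_re_lt_norm.2 him
  rw [hinv, Complex.add_conj, Complex.norm_real, Real.norm_eq_abs, abs_mul]
  norm_num
  linarith

/-- The letters other than `a` and `b` contribute `1` each, while `ζ + ζ⁻¹ = 2 Re ζ` has modulus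
below `2` unless `ζ = ±1`. -/
theorem norm_sum_ite_lt_card {a b : α} (hab : a ≠ b) {ζ : ℂ} (h1 : ‖ζ‖ = 1) (h2 : ζ ^ 2 ≠ 1) :
    ‖∑ c, if c = a then ζ else if c = b then ζ⁻¹ else 1‖ < Fintype.card α := by
  have hb : b ∈ Finset.univ.erase a := Finset.mem_erase.2 ⟨hab.symm, Finset.mem_univ b⟩
  rw [← Finset.add_sum_erase _ _ (Finset.mem_univ a), ← Finset.add_sum_erase _ _ hb]
  simp only [↓reduceIte, if_neg hab.symm]
  have hc : ∑ x ∈ (Finset.univ.erase a).erase b,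
      (if x = a then ζ else if x = b then ζ⁻¹ else 1) =
      (((Finset.univ.erase a).erase b).card : ℂ) := by
    rw [Finset.card_eq_sum_ones]
    push_cast
    refine Finset.sum_congr rfl fun x hx => ?_
    simp only [Finset.mem_erase] at hx
    rw [if_neg hx.2.1, if_neg hx.1]
  have h3 := Finset.card_erase_add_one hb
  have h4 := Finset.card_erase_add_one (Finset.mem_univ a)
  rw [Finset.card_univ] at h4
  rw [hc, ← add_assoc]
  refine (norm_add_le _ _).trans_lt ?_
  rw [Complex.norm_natCast, ← h4, ← h3]
  push_cast
  linarith [norm_add_inv_lt_two h1 h2]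

theorem mul_card_coordCount_sub_eq_le {a b : α} (hab : a ≠ b) {M : ℕ} {ω : ℂ}
    (hω : IsPrimitiveRoot ω M) (hM : M ≠ 0) (w : ℤ) (n : ℕ) :
    (M : ℝ) * (Finset.univ.filter fun y : Fin n → α =>
        (coordCount y a : ℤ) - coordCount y b = w).card ≤
      ∑ j ∈ Finset.range M,
        ‖∑ c : α, if c = a then ω ^ j else if c = b then (ω ^ j)⁻¹ else 1‖ ^ n := by
  have hω0 : ω ≠ 0 := hω.ne_zero hM
  have hn1 : ‖ω‖ = 1 := hω.norm'_eq_one hM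
  set W : (Fin n → α) → ℤ := fun y => (coordCount y a : ℤ) - coordCount y b with hW
  -- The root-of-unity sum detects `W y ≡ w` modulo `M`, which is weaker than equality; hence only
  -- an inequality.
  have key : ∀ y : Fin n → α, (if W y = w then (M : ℝ) else 0) ≤
      (∑ j ∈ Finset.range M, (ω ^ (W y - w)) ^ j).re := by
    intro y
    by_cases h : ω ^ (W y - w) = 1
    · simp only [h, one_pow, Finset.sum_const, Finset.card_range, nsmul_eq_mul, mul_one,
        Complex.natCast_re]
      split_ifs <;> simp
    · rw [if_neg (by rintro h'; simp [h'] at h)]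
      have h0 := mul_geom_sum (ω ^ (W y - w)) M
      have h5 : (ω ^ (W y - w)) ^ M = 1 := by
        rw [← zpow_natCast, zpow_comm, zpow_natCast, hω.pow_eq_one, one_zpow]
      rw [h5, sub_self] at h0
      rw [(mul_eq_zero.1 h0).resolve_left (sub_ne_zero.2 h)]
      simp
  calc (M : ℝ) * (Finset.univ.filter fun y => W y = w).card
      = ∑ y, if W y = w then (M : ℝ) else 0 := by
        rw [Finset.sum_ite]; simp [mul_comm]
    _ ≤ ∑ y, (∑ j ∈ Finset.range M, (ω ^ (W y - w)) ^ j).re := Finset.sum_le_sum fun y _ => key y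
    _ = (∑ j ∈ Finset.range M, (ω ^ j) ^ (-w) * ∑ y, (ω ^ j) ^ W y).re := by
        rw [← Complex.re_sum, Finset.sum_comm]
        congr 1
        refine Finset.sum_congr rfl fun j _ => ?_
        rw [Finset.mul_sum]
        refine Finset.sum_congr rfl fun y _ => ?_
        rw [← zpow_add₀ (pow_ne_zero _ hω0), ← zpow_natCast, zpow_comm, zpow_natCast]
        congr 1
        ring
    _ ≤ ‖∑ j ∈ Finset.range M, (ω ^ j) ^ (-w) * ∑ y, (ω ^ j) ^ W y‖ := Complex.re_le_norm _
    _ ≤ ∑ j ∈ Finset.range M, ‖(ω ^ j) ^ (-w) * ∑ y, (ω ^ j) ^ W y‖ := norm_sum_le _ _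
    _ = _ := by
        refine Finset.sum_congr rfl fun j _ => ?_
        rw [norm_mul, norm_zpow, norm_pow, hn1, one_pow, one_zpow, one_mul, hW,
          sum_zpow_coordCount_sub hab (pow_ne_zero _ hω0), norm_pow]

/-- The trivial root contributes a proportion `1 / M` and the others decay exponentially in `n`; `M`
is arbitrarily large. -/
theorem tendsto_card_coordCount_sub_eq {a b : α} (hab : a ≠ b) (w : ℤ) :
    Tendsto (fun n => ((Finset.univ.filter fun y : Fin n → α =>
        (coordCount y a : ℤ) - coordCount y b = w).card : ℝ) / (Fintype.card α : ℝ) ^ n)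
      atTop (𝓝 0) := by
  have hq : (0 : ℝ) < Fintype.card α := by exact_mod_cast Fintype.card_pos_iff.2 ⟨a⟩
  rw [Metric.tendsto_atTop']
  intro ε hε
  obtain ⟨k, hk⟩ := exists_nat_gt (2 / ε)
  -- An odd order ensures that no nontrivial `M`-th root of unity squares to `1`.
  set M := 2 * k + 1 with hMdef
  have hM0 : M ≠ 0 := by omega
  have hMpos : (0 : ℝ) < M := by positivity
  have hMε : 1 < M * (ε / 2) := by
    rw [div_lt_iff₀ hε] at hk
    rw [hMdef]; push_cast
    nlinarith [hk, hε, (Nat.cast_nonneg k : (0 : ℝ) ≤ k)]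
  have hω := Complex.isPrimitiveRoot_exp M hM0
  set ω := Complex.exp (2 * Real.pi * Complex.I / M)
  set S : ℕ → ℝ := fun j =>
    ‖∑ c : α, if c = a then ω ^ j else if c = b then (ω ^ j)⁻¹ else 1‖ with hS
  have hS0 : S 0 = Fintype.card α := by simp [hS]
  have hSj : ∀ j ∈ Finset.range (2 * k), S (j + 1) / Fintype.card α < 1 := by
    intro j hj
    rw [Finset.mem_range] at hj
    rw [div_lt_one hq]
    refine norm_sum_ite_lt_card hab (by rw [norm_pow, hω.norm'_eq_one hM0, one_pow]) ?_
    rw [← pow_mul, Ne, hω.pow_eq_one_iff_dvd]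
    intro hd
    have hcop : Nat.Coprime M 2 := by
      rw [Nat.coprime_two_right]
      exact ⟨k, rfl⟩
    have := Nat.le_of_dvd (by omega) (hcop.dvd_of_dvd_mul_right hd)
    omega
  have ht : Tendsto (fun n => ∑ j ∈ Finset.range (2 * k), (S (j + 1) / Fintype.card α) ^ n)
      atTop (𝓝 0) := by
    have := tendsto_finsetSum (Finset.range (2 * k)) fun j hj =>
      tendsto_pow_atTop_nhds_zero_of_lt_one (r := S (j + 1) / Fintype.card α)
        (by positivity) (hSj j hj)
    simpa using this
  obtain ⟨N, hN⟩ := eventually_atTop.1 (ht.eventually_lt_const (half_pos hε))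
  refine ⟨N, fun n hn => ?_⟩
  have h1 := mul_card_coordCount_sub_eq_le hab hω hM0 w n
  have h2 := hN n hn.le
  rw [hMdef, Finset.sum_range_succ', ← hMdef] at h1
  change _ ≤ ∑ j ∈ Finset.range (2 * k), S (j + 1) ^ n + S 0 ^ n at h1
  rw [hS0] at h1
  simp_rw [div_pow] at h2
  rw [← Finset.sum_div] at h2
  have hqn : (0 : ℝ) < (Fintype.card α : ℝ) ^ n := by positivity
  rw [div_lt_iff₀ hqn] at h2
  rw [dist_zero_right, Real.norm_of_nonneg (by positivity), div_lt_iff₀ hqn]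
  have hM1 : (1 : ℝ) ≤ M := by exact_mod_cast Nat.one_le_iff_ne_zero.2 hM0
  set C : ℝ := ((Finset.univ.filter fun y : Fin n → α =>
        (coordCount y a : ℤ) - coordCount y b = w).card : ℝ)
  refine lt_of_mul_lt_mul_left (a := (M : ℝ)) ?_ hMpos.le
  have h6 := mul_lt_mul_of_pos_right hMε hqn
  have h7 := mul_le_mul_of_nonneg_right hM1 (mul_pos (half_pos hε) hqn).le
  nlinarith

end Anticoncentration

/-! ### Words with a clear plurality letter. -/

section Plurality

variable {α : Type*} [DecidableEq α]

/-- `y` takes the value `a` more than `L` times more often than any other value. -/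
def IsPlurality {n : ℕ} (L : ℕ) (y : Fin n → α) (a : α) : Prop :=
  ∀ b, b ≠ a → coordCount y b + L < coordCount y a

theorem IsPlurality.unique {n L : ℕ} {y : Fin n → α} {a b : α}
    (ha : IsPlurality L y a) (hb : IsPlurality 0 y b) : a = b := by
  by_contra hab
  have h1 := ha b (Ne.symm hab)
  have h2 := hb a hab
  omega

theorem coordCount_le_add {n : ℕ} (y z : Fin n → α) (a : α) :
    coordCount y a ≤ coordCount z a + (Finset.univ.filter fun i => y i ≠ z i).card := by
  unfold coordCount
  refine (Finset.card_le_card fun i hi => ?_).trans (Finset.card_union_le _ _)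
  simp only [Finset.mem_union, Finset.mem_filter, Finset.mem_univ, true_and] at hi ⊢
  by_cases h : y i = z i
  · exact Or.inl (h ▸ hi)
  · exact Or.inr h

/-- Changing `K` coordinates moves each count by at most `K`, hence each lead by at most `2 * K`. -/
theorem IsPlurality.of_card_ne_le {n K : ℕ} {y z : Fin n → α} {a : α}
    (ha : IsPlurality (2 * K) y a) (hK : (Finset.univ.filter fun i => y i ≠ z i).card ≤ K) :
    IsPlurality 0 z a := by
  intro b hb
  have h1 := ha b hb
  have h2 := coordCount_le_add y z a
  have h3 := coordCount_le_add z y b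
  simp_rw [ne_comm (a := z _)] at h3
  omega

theorem IsPlurality.add_const [AddGroup α] {n L : ℕ} {y : Fin n → α} {a : α}
    (ha : IsPlurality L y a) (t : α) : IsPlurality L (fun i => y i + t) (a + t) := by
  have e : ∀ b, coordCount (fun i => y i + t) b = coordCount y (b - t) := by
    intro b
    simp only [coordCount, eq_sub_iff_add_eq]
  intro b hb
  rw [e, e, add_sub_cancel_right]
  exact ha _ fun h => hb (by rw [← h, sub_add_cancel])

theorem isPlurality_const {n L : ℕ} (h : L < n) (a : α) :
    IsPlurality L (fun _ : Fin n => a) a := by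
  intro b hb
  simpa [coordCount, hb.symm] using h

-- If the most frequent letter does not lead by more than `L`, some two distinct letters have counts
-- differing by at most `L`; this is a finite union of events of vanishing density.
open scoped Classical in
theorem tendsto_card_not_isPlurality [Fintype α] [Nonempty α] (L : ℕ) :
    Tendsto (fun n => ((Finset.univ.filter fun y : Fin n → α =>
        ¬ ∃ a, IsPlurality L y a).card : ℝ) / (Fintype.card α : ℝ) ^ n) atTop (𝓝 0) := by
  set P := (Finset.univ : Finset (α × α)).filter (fun q => q.1 ≠ q.2)
  have ht := tendsto_finsetSum (P ×ˢ Finset.Icc (-(L : ℤ)) L)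
    fun q hq => tendsto_card_coordCount_sub_eq (a := q.1.1) (b := q.1.2)
      (Finset.mem_filter.1 (Finset.mem_product.1 hq).1).2 q.2
  simp only [Finset.sum_const_zero] at ht
  refine squeeze_zero (fun n => by positivity) (fun n => ?_) ht
  rw [← Finset.sum_div]
  gcongr
  norm_cast
  refine le_trans (Finset.card_le_card fun y hy => ?_) Finset.card_biUnion_le
  obtain ⟨a, -, ha⟩ := Finset.exists_max_image Finset.univ (coordCount y)
    Finset.univ_nonempty
  have hy' := not_exists.1 (Finset.mem_filter.1 hy).2 a
  simp only [IsPlurality, not_forall, not_lt] at hy'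
  obtain ⟨b, hb, hle⟩ := hy'
  have hba := ha b (Finset.mem_univ b)
  refine Finset.mem_biUnion.2 ⟨((a, b), (coordCount y a : ℤ) - coordCount y b), ?_, ?_⟩
  · simp only [P, Finset.mem_product, Finset.mem_filter, Finset.mem_univ, true_and,
      Finset.mem_Icc]
    exact ⟨hb.symm, by omega, by omega⟩
  · simpa using Int.subNatNat_eq_coe

end Plurality

/-! ### Initial subgroups and coordinate blocks. -/

section Blocks

variable {p : ℕ}

/-- The subgroup of the vectors whose coordinates of index at least `m` vanish. -/
def initialSubgroup (p m : ℕ) : AddSubgroup (Gp p) where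
  carrier := {x | ∀ j, m ≤ j → x j = 0}
  zero_mem' := fun _ _ => rfl
  add_mem' := fun hx hy j hj => by simp [hx j hj, hy j hj]
  neg_mem' := fun hx j hj => by simp [hx j hj]

theorem mem_initialSubgroup {m : ℕ} {x : Gp p} :
    x ∈ initialSubgroup p m ↔ ∀ j, m ≤ j → x j = 0 := Iff.rfl

theorem initialSubgroup_mono {m n : ℕ} (h : m ≤ n) :
    initialSubgroup p m ≤ initialSubgroup p n := fun _ hx j hj => hx j (h.trans hj)

theorem exists_mem_initialSubgroup (x : Gp p) : ∃ m, x ∈ initialSubgroup p m := by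
  refine ⟨x.support.sup id + 1, fun j hj => ?_⟩
  by_contra h
  have := Finset.le_sup (f := id) (Finsupp.mem_support_iff.2 h)
  simp only [id] at this
  omega

theorem single_zero_mem_initialSubgroup {m : ℕ} (hm : 0 < m) (a : ZMod p) :
    (Finsupp.single 0 a : Gp p) ∈ initialSubgroup p m := fun j hj =>
  Finsupp.single_eq_of_ne (by omega)

theorem zmod_smul_mem_initialSubgroup {m : ℕ} {x : Gp p} (hx : x ∈ initialSubgroup p m)
    (a : ZMod p) : a • x ∈ initialSubgroup p m := fun j hj => by simp [hx j hj]

/-- The embedding of `(ZMod p)ⁿ` as the coordinates of index `m, …, m + n - 1`. -/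
noncomputable def blockEmbedding (p m n : ℕ) : (Fin n → ZMod p) →+ Gp p :=
  ∑ i : Fin n, (Finsupp.singleAddHom (m + i)).comp (Pi.evalAddMonoidHom _ i)

theorem blockEmbedding_apply (m n : ℕ) (y : Fin n → ZMod p) (j : ℕ) :
    blockEmbedding p m n y j = ∑ i : Fin n, if m + (i : ℕ) = j then y i else 0 := by
  simp [blockEmbedding, Finsupp.finsetSum_apply, Finsupp.single_apply]

theorem blockEmbedding_apply_add (m : ℕ) {n : ℕ} (y : Fin n → ZMod p) (i : Fin n) :
    blockEmbedding p m n y (m + i) = y i := by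
  simp [blockEmbedding_apply, Fin.val_inj]

theorem blockEmbedding_apply_of_lt {m n j : ℕ} (y : Fin n → ZMod p) (hj : j < m) :
    blockEmbedding p m n y j = 0 := by
  rw [blockEmbedding_apply]
  exact Finset.sum_eq_zero fun i _ => if_neg (by omega)

theorem blockEmbedding_mem (m n : ℕ) (y : Fin n → ZMod p) :
    blockEmbedding p m n y ∈ initialSubgroup p (m + n) := by
  intro j hj
  rw [blockEmbedding_apply]
  exact Finset.sum_eq_zero fun i _ => if_neg (by omega)

theorem eq_of_add_blockEmbedding_eq {m n : ℕ} {x x' : Gp p} {y y' : Fin n → ZMod p}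
    (hx : x ∈ initialSubgroup p m) (hx' : x' ∈ initialSubgroup p m)
    (h : x + blockEmbedding p m n y = x' + blockEmbedding p m n y') : x = x' ∧ y = y' := by
  have hy : y = y' := by
    funext i
    have := DFunLike.congr_fun h (m + (i : ℕ))
    simpa [blockEmbedding_apply_add, hx (m + i) (by omega), hx' (m + i) (by omega)] using this
  subst hy
  exact ⟨add_right_cancel h, rfl⟩

theorem blockEmbedding_injective (m n : ℕ) : Function.Injective (blockEmbedding p m n) :=
  fun y y' h => (eq_of_add_blockEmbedding_eq (x := 0) (x' := 0) (zero_mem _) (zero_mem _)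
    (by rw [h])).2

/-- The subgroup `initialSubgroup p m` as a finset. -/
noncomputable def initialFinset (p m : ℕ) [NeZero p] : Finset (Gp p) :=
  Finset.univ.map ⟨blockEmbedding p 0 m, blockEmbedding_injective 0 m⟩

theorem card_initialFinset (p m : ℕ) [NeZero p] : (initialFinset p m).card = p ^ m := by
  simp [initialFinset, ZMod.card]

theorem mem_initialFinset {m : ℕ} [NeZero p] {x : Gp p} :
    x ∈ initialFinset p m ↔ x ∈ initialSubgroup p m := by
  simp only [initialFinset, Finset.mem_map, Finset.mem_univ, true_and,
    Function.Embedding.coeFn_mk]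
  constructor
  · rintro ⟨y, rfl⟩
    simpa using blockEmbedding_mem 0 m y
  · intro hx
    refine ⟨fun i => x i, ?_⟩
    ext j
    by_cases hj : j < m
    · simpa using blockEmbedding_apply_add 0 (fun i : Fin m => x i) ⟨j, hj⟩
    · rw [hx j (by omega)]
      exact blockEmbedding_mem 0 m _ j (by omega)

theorem coe_initialFinset (p m : ℕ) [NeZero p] :
    (initialFinset p m : Set (Gp p)) = initialSubgroup p m := by
  ext x; exact mem_initialFinset

end Blocks

/-! ### Sparse perturbations of the all-ones vector in a kernel. -/

/-- Write `1` as the sum of the basis vectors and subtract, for each of them, a chosen basis vector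
with the same image under `f`. The images lie in `T`, so at most `T.card` representatives occur,
whatever `n` is. -/
theorem exists_card_ne_zero_le_map_one_add_eq_zero {p n : ℕ} [NeZero p] {H : Type*}
    [AddCommGroup H] (f : (Fin n → ZMod p) →+ H) (T : Finset H) (hT : ∀ x : H, p • x = 0 → x ∈ T) :
    ∃ u : Fin n → ZMod p, (Finset.univ.filter fun i => u i ≠ 0).card ≤ T.card ∧
      f (1 + u) = 0 := by
  classical
  set h : Fin n → H := fun i => f (Pi.single i 1) with hh
  have hhT : ∀ i, h i ∈ T := fun i => hT _ <| by
    rw [hh, ← map_nsmul]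
    simp [← Pi.single_smul]
  set s : Fin n → Fin n := fun i => Set.rangeSplitting h ⟨h i, i, rfl⟩ with hs
  have hs' : ∀ i, h (s i) = h i := fun i => Set.apply_rangeSplitting h _
  refine ⟨-∑ i, Pi.single (s i) 1, ?_, ?_⟩
  · refine le_trans (Finset.card_le_card (t := Finset.univ.image s) fun i hi => ?_) ?_
    · by_contra hi'
      refine (Finset.mem_filter.1 hi).2 ?_
      rw [Pi.neg_apply, Finset.sum_apply, neg_eq_zero]
      refine Finset.sum_eq_zero fun j _ => Pi.single_eq_of_ne ?_ _
      rintro rfl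
      exact hi' (Finset.mem_image_of_mem s (Finset.mem_univ j))
    · refine Finset.card_le_card_of_injOn h (fun i _ => hhT i) ?_
      intro i hi j hj hij
      simp only [Finset.coe_image, Finset.coe_univ, Set.image_univ, Set.mem_range] at hi hj
      obtain ⟨i, rfl⟩ := hi
      obtain ⟨j, rfl⟩ := hj
      rw [hs', hs'] at hij
      simp only [hs, hij]
  · have h1 : (1 : Fin n → ZMod p) = ∑ i, Pi.single i 1 := by
      rw [← Finset.univ_sum_single (1 : Fin n → ZMod p)]; rfl
    rw [h1, map_add, map_neg, map_sum, map_sum, add_neg_eq_zero]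
    exact Finset.sum_congr rfl fun i _ => (hs' i).symm

/-! ### The extension step. -/

section Step

/-- A finite set supported on the first `level` coordinates whose difference set omits the first
basis vector. -/
structure Stage (p : ℕ) where
  level : ℕ
  level_pos : 0 < level
  carrier : Finset (Gp p)
  carrier_subset : ∀ x ∈ carrier, x ∈ initialSubgroup p level
  single_notMem : (Finsupp.single 0 1 : Gp p) ∉ (carrier : Set (Gp p)) - (carrier : Set (Gp p))

/-- The proportion of `initialSubgroup p S.level` occupied by `S`. -/
noncomputable def Stage.density {p : ℕ} (S : Stage p) : ℝ := (S.carrier.card : ℝ) / (p : ℝ) ^ S.level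

theorem Stage.density_le_one {p : ℕ} [NeZero p] (S : Stage p) : S.density ≤ 1 := by
  refine div_le_one_of_le₀ ?_ (by positivity)
  have := Finset.card_le_card (t := initialFinset p S.level)
    fun x hx => mem_initialFinset.2 (S.carrier_subset x hx)
  rw [card_initialFinset] at this
  exact_mod_cast this

-- Omitted differences inside the old subgroup survive because such a difference forces equal
-- blocks, hence equal shifts, which cancel.
open scoped Classical in
theorem Stage.exists_extension {p : ℕ} [Fact p.Prime] (S : Stage p) {g : Gp p}
    (hg : g ∈ initialSubgroup p S.level) (K : ℕ) {η : ℝ} (hη : 0 < η) :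
    ∃ (S' : Stage p) (n : ℕ), 0 < n ∧ S'.level = S.level + n ∧ S.carrier ⊆ S'.carrier ∧
      S.density - η ≤ S'.density ∧
      (∀ s ∈ initialSubgroup p S.level, s ∉ (S.carrier : Set (Gp p)) - (S.carrier : Set (Gp p)) →
        s ∉ (S'.carrier : Set (Gp p)) - (S'.carrier : Set (Gp p))) ∧
      ∀ u : Fin n → ZMod p, (Finset.univ.filter fun i => u i ≠ 0).card ≤ K →
        g + blockEmbedding p S.level n (1 + u) ∉
          (S'.carrier : Set (Gp p)) - (S'.carrier : Set (Gp p)) := by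
  obtain ⟨n, hnη, hnK⟩ := (((tendsto_card_not_isPlurality (α := ZMod p) (2 * K)).eventually_lt_const
    hη).and (eventually_gt_atTop (2 * K))).exists
  set m := S.level with hm
  set A := S.carrier with hA
  set e : Gp p := Finsupp.single 0 1 with he
  have heH : e ∈ initialSubgroup p m := single_zero_mem_initialSubgroup S.level_pos 1
  set D : Finset (Fin n → ZMod p) := Finset.univ.filter fun y => ∃ a, IsPlurality (2 * K) y a
  -- The default `0` is harmless: only blocks in `D` enter `A'`.
  set c : (Fin n → ZMod p) → ZMod p := fun y =>
    if h : ∃ a, IsPlurality (2 * K) y a then h.choose else 0 with hc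
  have hcD : ∀ y ∈ D, IsPlurality (2 * K) y (c y) := by
    intro y hy
    have hy' := (Finset.mem_filter.1 hy).2
    simp only [hc, dif_pos hy']
    exact hy'.choose_spec
  have hweak : ∀ {y : Fin n → ZMod p} {a : ZMod p}, IsPlurality (2 * K) y a → IsPlurality 0 y a :=
    fun h b hb => by have := h b hb; omega
  set φ : Gp p × (Fin n → ZMod p) → Gp p := fun q =>
    q.1 + c q.2 • (g + e) + blockEmbedding p m n q.2 with hφ
  have hH : ∀ x ∈ A, ∀ y, x + c y • (g + e) ∈ initialSubgroup p m := fun x hx y =>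
    add_mem (S.carrier_subset x hx) (zmod_smul_mem_initialSubgroup (add_mem hg heH) _)
  set A' : Finset (Gp p) := (A ×ˢ D).image φ
  have hmem : ∀ {z}, z ∈ A' ↔ ∃ x ∈ A, ∃ y ∈ D,
      x + c y • (g + e) + blockEmbedding p m n y = z := by
    intro z
    simp [A', φ, and_assoc]
  have hold : ∀ s ∈ initialSubgroup p m, s ∉ (A : Set (Gp p)) - (A : Set (Gp p)) →
      s ∉ (A' : Set (Gp p)) - (A' : Set (Gp p)) := by
    rintro s hs hsA ⟨a, ha, b, hb, rfl⟩
    obtain ⟨x, hx, y, hy, rfl⟩ := hmem.1 ha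
    obtain ⟨x', hx', y', hy', rfl⟩ := hmem.1 hb
    dsimp only at hs hsA
    obtain ⟨h1, rfl⟩ := eq_of_add_blockEmbedding_eq (hH x hx y) (add_mem hs (hH x' hx' y'))
      (by abel : _ = _ + blockEmbedding p m n y')
    exact hsA ⟨x, hx, x', hx', by simp⟩
  have hcard : A'.card = A.card * D.card := by
    rw [Finset.card_image_of_injOn, Finset.card_product]
    rintro ⟨x, y⟩ hq ⟨x', y'⟩ hq' h
    simp only [Finset.coe_product, Set.mem_prod, Finset.mem_coe] at hq hq'
    obtain ⟨h1, rfl⟩ := eq_of_add_blockEmbedding_eq (hH x hq.1 y) (hH x' hq'.1 y') h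
    rw [add_right_cancel h1]
  refine ⟨⟨m + n, by have := S.level_pos; omega, A', ?_, hold e heH S.single_notMem⟩, n,
    by omega, rfl, ?_, ?_, hold, ?_⟩
  · intro z hz
    obtain ⟨x, hx, y, hy, rfl⟩ := hmem.1 hz
    exact add_mem (initialSubgroup_mono (by omega) (hH x hx y)) (blockEmbedding_mem m n y)
  · intro x hx
    -- The zero block has plurality letter `0`, so it carries an unshifted copy of `A`.
    have h0 : IsPlurality (2 * K) (0 : Fin n → ZMod p) 0 := isPlurality_const hnK 0
    have h0D : (0 : Fin n → ZMod p) ∈ D := Finset.mem_filter.2 ⟨Finset.mem_univ _, 0, h0⟩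
    refine hmem.2 ⟨x, hx, 0, h0D, ?_⟩
    rw [(hcD 0 h0D).unique (hweak h0)]
    simp
  · have hp0 : (0 : ℝ) < p := by exact_mod_cast (Fact.out : p.Prime).pos
    have hD : (D.card : ℝ) = (p : ℝ) ^ n - (Finset.univ.filter fun y : Fin n → ZMod p =>
        ¬ ∃ a, IsPlurality (2 * K) y a).card := by
      rw [eq_sub_iff_add_eq]
      have := Finset.card_filter_add_card_filter_not (s := Finset.univ)
        (fun y : Fin n → ZMod p => ∃ a, IsPlurality (2 * K) y a)
      rw [Finset.card_univ, Fintype.card_fun, ZMod.card, Fintype.card_fin] at this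
      exact_mod_cast this
    rw [ZMod.card] at hnη
    have h1 := S.density_le_one
    change _ ≤ ((A'.card : ℝ) / (p : ℝ) ^ (m + n))
    rw [hcard, pow_add, Nat.cast_mul, mul_div_mul_comm, hD, sub_div,
      div_self (by positivity)]
    change S.density - η ≤ S.density * _
    have h0 : 0 ≤ S.density := by unfold Stage.density; positivity
    nlinarith
  · rintro u hu ⟨a, ha, b, hb, hab⟩
    obtain ⟨x', hx', y', hy', rfl⟩ := hmem.1 ha
    obtain ⟨x, hx, y, hy, rfl⟩ := hmem.1 hb
    dsimp only at hab
    have h2 : x' + c y' • (g + e) + blockEmbedding p m n y' =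
        (x + c y • (g + e) + g) + blockEmbedding p m n (y + 1 + u) := by
      rw [sub_eq_iff_eq_add.1 hab]
      simp only [map_add]
      abel
    obtain ⟨h3, rfl⟩ := eq_of_add_blockEmbedding_eq (hH x' hx' y')
      (add_mem (hH x hx y) hg) h2
    -- Adding `1` relabels the letters, and the margin `2 * K` absorbs the at most `K` changes made
    -- by `u`.
    have h4 : c (y + 1 + u) = c y + 1 := by
      refine (hcD _ hy').unique ?_
      refine ((hcD _ hy).add_const 1).of_card_ne_le (K := K) ?_
      simpa using hu
    rw [h4, add_smul, one_smul] at h3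
    refine S.single_notMem ⟨x, hx, x', hx', ?_⟩
    have h5 : x' + (g + e) = x + g := by
      have : (x' + (g + e)) + c y • (g + e) = (x + g) + c y • (g + e) := by
        rw [← sub_eq_zero] at h3 ⊢
        rw [← h3]; abel
      exact add_right_cancel this
    change x - x' = e
    rw [sub_eq_iff_eq_add, ← sub_eq_zero]
    rw [← sub_eq_zero] at h5
    rw [← neg_eq_zero, ← h5]; abel

end Step

/-! ### Bohr neighborhoods and finite sets of characters. -/

theorem IsBohrNhd.exists_finset {G : Type*} [AddCommGroup G] {B : Set G} {g : G}
    (hB : IsBohrNhd B g) :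
    ∃ I : Finset (G →+ UnitAddCircle), ∀ x, (∀ ρ ∈ I, ρ x = ρ g) → x ∈ B := by
  unfold IsBohrNhd at hB
  rw [nhds_iInf, Filter.mem_iInf] at hB
  obtain ⟨I, hI, V, hV, rfl⟩ := hB
  refine ⟨hI.toFinset, fun x hx => Set.mem_iInter.2 fun ρ => ?_⟩
  have h := hV ρ
  rw [nhds_induced] at h
  obtain ⟨U, hU, hUV⟩ := h
  refine hUV ?_
  rw [Set.mem_preimage, hx ρ (hI.mem_toFinset.2 ρ.2)]
  exact mem_of_mem_nhds hU

/-- The points of order dividing `p` on the circle. -/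
noncomputable def circleTorsion (p : ℕ) [NeZero p] : Finset UnitAddCircle :=
  (AddCircle.finite_torsion (1 : ℝ) (NeZero.pos p)).toFinset

theorem mem_circleTorsion {p : ℕ} [NeZero p] {x : UnitAddCircle} :
    x ∈ circleTorsion p ↔ p • x = 0 := by
  simp [circleTorsion]

theorem exists_card_ne_zero_le_forall_map_eq_zero {p : ℕ} [NeZero p] (m n : ℕ)
    (I : Finset (Gp p →+ UnitAddCircle)) :
    ∃ u : Fin n → ZMod p,
      (Finset.univ.filter fun i => u i ≠ 0).card ≤ (circleTorsion p).card ^ I.card ∧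
      ∀ ρ ∈ I, ρ (blockEmbedding p m n (1 + u)) = 0 := by
  classical
  obtain ⟨u, hu, hu0⟩ := exists_card_ne_zero_le_map_one_add_eq_zero
    (f := (AddMonoidHom.pi fun ρ : I => (ρ : Gp p →+ UnitAddCircle)).comp
      (blockEmbedding p m n))
    (T := Fintype.piFinset fun _ : I => circleTorsion p)
    fun x hx => Fintype.mem_piFinset.2 fun ρ => mem_circleTorsion.2 (congrFun hx ρ)
  refine ⟨u, by simpa using hu, fun ρ hρ => congrFun hu0 ⟨ρ, hρ⟩⟩

theorem Stage.exists_extension_forall_finset {p : ℕ} [Fact p.Prime] (S : Stage p) (g : Gp p)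
    (K : ℕ) {η : ℝ} (hη : 0 < η) :
    ∃ S' : Stage p, S.level < S'.level ∧ S.carrier ⊆ S'.carrier ∧
      S.density - η ≤ S'.density ∧
      (∀ s ∈ initialSubgroup p S.level, s ∉ (S.carrier : Set (Gp p)) - (S.carrier : Set (Gp p)) →
        s ∉ (S'.carrier : Set (Gp p)) - (S'.carrier : Set (Gp p))) ∧
      (g ∈ initialSubgroup p S.level → ∀ I : Finset (Gp p →+ UnitAddCircle),
        (circleTorsion p).card ^ I.card ≤ K → ∃ s ∈ initialSubgroup p S'.level,
          s ∉ (S'.carrier : Set (Gp p)) - (S'.carrier : Set (Gp p)) ∧ ∀ ρ ∈ I, ρ s = ρ g) := by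
  classical
  by_cases hg : g ∈ initialSubgroup p S.level
  · obtain ⟨S', n, hn, hl, h1, h2, h3, h4⟩ := S.exists_extension hg K hη
    refine ⟨S', by omega, h1, h2, h3, fun _ I hI => ?_⟩
    obtain ⟨u, hu, hu0⟩ := exists_card_ne_zero_le_forall_map_eq_zero S.level n I
    refine ⟨_, ?_, h4 u (hu.trans hI), fun ρ hρ => by rw [map_add, hu0 ρ hρ, add_zero]⟩
    rw [hl]
    exact add_mem (initialSubgroup_mono (by omega) hg) (blockEmbedding_mem _ _ _)
  -- Here `g` is not yet reachable; the extension with `0` serves only to raise the level.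
  · obtain ⟨S', n, hn, hl, h1, h2, h3, -⟩ := S.exists_extension (zero_mem _) K hη
    exact ⟨S', by omega, h1, h2, h3, fun h => absurd h hg⟩

/-! ### The initial stage and the limit set. -/

theorem exists_stage_density_eq {p : ℕ} (hp : p.Prime) :
    ∃ S : Stage p, S.density = criticalDensity p := by
  have : NeZero p := ⟨hp.ne_zero⟩
  set f : ℕ → Gp p := fun j => Finsupp.single 0 ((2 * j : ℕ) : ZMod p) with hf
  have hcast : ∀ a b : ℕ, a < p → b < p → (a : ZMod p) = b → a = b := fun a b ha hb h => by
    have := congrArg ZMod.val h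
    rwa [ZMod.val_natCast_of_lt ha, ZMod.val_natCast_of_lt hb] at this
  have hinj : Set.InjOn f (Finset.range (p / 2)) := by
    intro i hi j hj h
    simp only [Finset.coe_range, Set.mem_Iio] at hi hj
    have := hcast _ _ (by omega) (by omega) (Finsupp.single_injective 0 h)
    omega
  refine ⟨⟨1, one_pos, (Finset.range (p / 2)).image f, ?_, ?_⟩, ?_⟩
  · intro x hx
    obtain ⟨j, -, rfl⟩ := Finset.mem_image.1 hx
    exact single_zero_mem_initialSubgroup one_pos _
  · rintro ⟨a, ha, b, hb, hab⟩
    obtain ⟨i, hi, rfl⟩ := Finset.mem_image.1 (Finset.mem_coe.1 ha)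
    obtain ⟨j, hj, rfl⟩ := Finset.mem_image.1 (Finset.mem_coe.1 hb)
    rw [Finset.mem_range] at hi hj
    dsimp only [hf] at hab
    rw [← Finsupp.single_sub] at hab
    have h1 := sub_eq_iff_eq_add.1 (Finsupp.single_injective 0 hab)
    -- Since `i, j < p / 2`, both sides are below `p`, so parity decides without wraparound.
    have := hcast (2 * i) (1 + 2 * j) (by omega) (by omega) (by rw [h1]; push_cast; ring)
    omega
  · rw [criticalDensity_eq hp, Stage.density]
    simp only [pow_one]
    rw [Finset.card_image_of_injOn hinj, Finset.card_range]

theorem exists_seq_forall_frequently_eq (α : Type*) [Nonempty α] [Countable α] :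
    ∃ e : ℕ → α, ∀ a N, ∃ i ≥ N, e i = a := by
  obtain ⟨f, hf⟩ := exists_surjective_nat α
  refine ⟨fun i => f i.unpair.1, fun a N => ?_⟩
  obtain ⟨k, rfl⟩ := hf a
  exact ⟨Nat.pair k N, Nat.right_le_pair k N, by simp⟩

theorem exists_density_gt_forall_not_isBohrNhd_subset {p : ℕ} (hp : p.Prime) {ε : ℝ}
    (hε : 0 < ε) : ∃ A : Set (Gp p), criticalDensity p - ε < upperBanachDensity A ∧
      ∀ (g : Gp p) (B : Set (Gp p)), IsBohrNhd B g → ¬ B ⊆ A - A := by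
  have : Fact p.Prime := ⟨hp⟩
  have : NeZero p := ⟨hp.ne_zero⟩
  obtain ⟨S₀, hS₀⟩ := exists_stage_density_eq hp
  obtain ⟨e, he⟩ := exists_seq_forall_frequently_eq (Gp p)
  -- The losses sum to at most `ε / 2`, which keeps the final inequality strict; the sparsity bound
  -- at step `i` is `i` itself.
  choose F hlevel hsub hdens hold hnew using fun (i : ℕ) (S : Stage p) =>
    S.exists_extension_forall_finset (e i) i (η := ε / 2 * (1 / 2) ^ (i + 1)) (by positivity)
  let S : ℕ → Stage p := fun i => Nat.rec S₀ F i
  have hS : ∀ i, S (i + 1) = F i (S i) := fun _ => rfl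
  have hlev : StrictMono fun i => (S i).level := strictMono_nat_of_lt_succ fun i => hlevel i (S i)
  have hmono : Monotone fun i => (S i).carrier := monotone_nat_of_le_succ fun i => hsub i (S i)
  have hdensity : ∀ i, S₀.density - ε / 2 * (1 - (1 / 2) ^ i) ≤ (S i).density := by
    intro i
    induction i with
    | zero => simp [S]
    | succ i ih =>
      have h := hdens i (S i)
      rw [hS]
      rw [pow_succ] at h ⊢
      linarith
  have hkeep : ∀ i s, s ∈ initialSubgroup p (S i).level →
      s ∉ ((S i).carrier : Set (Gp p)) - ((S i).carrier : Set (Gp p)) → ∀ j, i ≤ j →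
      s ∉ ((S j).carrier : Set (Gp p)) - ((S j).carrier : Set (Gp p)) := by
    intro i s hs hsi j hij
    induction j, hij using Nat.le_induction with
    | base => exact hsi
    | succ j hij ih =>
      exact hold j (S j) s (initialSubgroup_mono (hlev.monotone hij) hs) ih
  set A : Set (Gp p) := ⋃ i, ((S i).carrier : Set (Gp p)) with hA
  have hlimit : ∀ i s, s ∈ initialSubgroup p (S i).level →
      s ∉ ((S i).carrier : Set (Gp p)) - ((S i).carrier : Set (Gp p)) → s ∉ A - A := by
    rintro i s hs hsi ⟨a, ha, b, hb, rfl⟩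
    obtain ⟨j, hj⟩ := Set.mem_iUnion.1 ha
    obtain ⟨k, hk⟩ := Set.mem_iUnion.1 hb
    refine hkeep i _ hs hsi (max i (max j k)) (le_max_left _ _) ⟨a, ?_, b, ?_, rfl⟩
    · exact hmono ((le_max_left j k).trans (le_max_right _ _)) hj
    · exact hmono ((le_max_right j k).trans (le_max_right _ _)) hk
  refine ⟨A, ?_, fun g B hB hBA => ?_⟩
  · set Φ : ℕ → Finset (Gp p) := fun i => initialFinset p (S i).level with hΦ
    have hF : IsFolnerSeq Φ := by
      refine isFolnerSeq_of_eventually_vadd_eq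
        (fun i => ⟨0, mem_initialFinset.2 (zero_mem _)⟩) fun g => ?_
      obtain ⟨m, hm⟩ := exists_mem_initialSubgroup g
      filter_upwards [eventually_ge_atTop m] with i hi
      have hgi : g ∈ initialSubgroup p (S i).level :=
        initialSubgroup_mono (hi.trans (hlev.id_le i)) hm
      rw [hΦ, coe_initialFinset]
      ext x
      rw [Set.mem_vadd_set_iff_neg_vadd_mem, vadd_eq_add]
      exact AddSubgroup.add_mem_cancel_left _ (neg_mem hgi)
    have hle : criticalDensity p - ε / 2 ≤ upperDensity Φ A := by
      refine le_upperDensity (Eventually.of_forall fun i => ?_)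
      have h1 : (S i).density ≤ ((A ∩ (Φ i : Set (Gp p))).ncard : ℝ) / ((Φ i).card : ℝ) := by
        rw [Stage.density, hΦ, card_initialFinset]
        push_cast
        gcongr
        rw [← Set.ncard_coe_finset]
        refine Set.ncard_le_ncard (fun x hx => ⟨Set.mem_iUnion.2 ⟨i, hx⟩, ?_⟩)
          ((Finset.finite_toSet _).inter_of_right _)
        exact Finset.mem_coe.2 (mem_initialFinset.2 ((S i).carrier_subset x hx))
      have h2 := hdensity i
      rw [hS₀] at h2
      have h3 : 0 ≤ ε / 2 * (1 / 2 : ℝ) ^ i := by positivity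
      linarith
    linarith [upperDensity_le_upperBanachDensity hF A]
  · obtain ⟨I, hI⟩ := hB.exists_finset
    obtain ⟨m, hm⟩ := exists_mem_initialSubgroup g
    -- A late enough visit to `g`: the level has passed `m`, and the sparsity bound `i` suffices for
    -- `I`.
    obtain ⟨i, hi, rfl⟩ := he g (max m ((circleTorsion p).card ^ I.card))
    have hgi : e i ∈ initialSubgroup p (S i).level :=
      initialSubgroup_mono (((le_max_left _ _).trans hi).trans (hlev.id_le i)) hm
    obtain ⟨s, hs, hsn, hsI⟩ := hnew i (S i) hgi I ((le_max_right _ _).trans hi)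
    exact hlimit (i + 1) s hs hsn (hBA (hI s hsI))

theorem theorem1p2 (p : ℕ) (hp : p.Prime) :
    (∀ ε : ℝ, 0 < ε → ∃ A : Set (Gp p),
      criticalDensity p - ε < upperBanachDensity A ∧
        ∀ (g : Gp p) (B : Set (Gp p)), IsBohrNhd B g → ¬ B ⊆ A - A) ∧
    (∀ A : Set (Gp p), criticalDensity p < upperBanachDensity A → A - A = Set.univ) := by
  refine ⟨fun ε hε => exists_density_gt_forall_not_isBohrNhd_subset hp hε, fun A hA => ?_⟩
  have : NeZero p := ⟨hp.ne_zero⟩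
  refine Set.eq_univ_of_forall fun g => by_contra fun hg => ?_
  rw [criticalDensity_eq hp] at hA
  exact absurd hA (upperBanachDensity_le_of_notMem_sub hg).not_gt
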